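/- For a sequence $A=(A_n)_{n\ge 0}$ of strictly positive reals, let $C_A\{\mathbb R\}$ be the set of all $C^\infty$ functions $f:\mathbb R\to\mathbb C$ such that for every compact interval $K\subset\mathbb R$ there are constants $C_K,\rho_K>0$ with $\sup_{K}|f^{(n)}|\le C_K\rho_K^{\,n}A_n$ for all $n\in\mathbb N$. The class is called nonquasianalytic if it contains a function that is not identically zero and that vanishes at some point together with all its derivatives. A sequence $(A_n)$ is almost increasing if there is $C>0$ with $A_p\le CA_q$ whenever $p\le q$. Let $a<b$ be real numbers and let $M=(M_n)_{n\ge0}$ be a sequence of strictly positive reals such that $C_M\{\mathbb R\}$ is nonquasianalytic and 1. the sequence $\big((M_n/n!)^{1/n}\big)_{n\ge1}$ is almost increasing; 2. $1=M_0\le M_1$; 3. $\Big(\frac{M_{n+1}}{(n+1)!}\Big)^2\le\frac{M_n}{n!}\,\frac{M_{n+2}}{(n+2)!}$ for all $n\in\mathbb N$; 4. $\sup_{n\ge1}\Big(\frac{M_{n+1}}{(n+1)M_n}\Big)^{1/n}<+\infty$; 5. $\liminf_{n\to+\infty}(M_n/n!)^{1/n}>0$ (the value $+\infty$ is allowed).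 Let $\psi:\mathbb R\to\mathbb R$ and $\chi:\mathbb R\to\mathbb C$ belong to $C_M\{\mathbb R\}$, and suppose that $\psi(s)>s$ and $\psi'(s)>0$ for all $s\in\mathbb R$ and $\lim_{t\to-\infty}\psi(t)=-\infty$. Then $\psi$ is a bijection of $\mathbb R$; for $n\in\mathbb N$ let $\psi^{\langle n\rangle}$ be its $n$-th iterate and $\psi^{\langle -n\rangle}$ the $n$-th iterate of its inverse. For $s,t\in\mathbb R$ put $$\mathcal N^+_{\psi,t}(s)=\min\{p\in\mathbb N:\psi^{\langle p\rangle}(s)\ge t\},\qquad \mathcal N^-_{\psi,t}(s)=\min\{p\in\mathbb N:\psi^{\langle -p\rangle}(s)\le t\},$$ where $\mathbb N=\{0,1,2,\dots\}$. Then the cohomological equation $f-f\circ\psi=\chi$ has a solution $g\in C_M\{\mathbb R\}$ such that, for every $s\in\mathbb R$, $$|g(s)|\le\sum_{-\mathcal N^-_{\psi,a}(s)\le n\le\mathcal N^+_{\psi,b}(s)-1}\big|\chi(\psi^{\langle n\rangle}(s))\big|.$$ -/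

import Mathlib

open Filter
open scoped ContDiff Nat Topology

/-- The Carleman class `C_A{ℝ}`: smooth functions `f : ℝ → ℂ` such that on every compact interval
`[α, β]` one has `sup_{[α, β]} |f⁽ⁿ⁾| ≤ C ρⁿ Aₙ` for all `n`, with constants `C, ρ > 0` that may
depend on the interval. -/
def CarlemanClass (A : ℕ → ℝ) : Set (ℝ → ℂ) :=
  {f | ContDiff ℝ ∞ f ∧
    ∀ α β : ℝ, ∃ C > (0 : ℝ), ∃ ρ > (0 : ℝ), ∀ n : ℕ, ∀ x ∈ Set.Icc α β,
      ‖iteratedDeriv n f x‖ ≤ C * ρ ^ n * A n}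

/-- `C_A{ℝ}` is nonquasianalytic: it contains a function that is not identically zero and
vanishes at some point together with all its derivatives. -/
def Nonquasianalytic (A : ℕ → ℝ) : Prop :=
  ∃ f ∈ CarlemanClass A, (∃ x, f x ≠ 0) ∧ ∃ x₀ : ℝ, ∀ n : ℕ, iteratedDeriv n f x₀ = 0

/-- A sequence is almost increasing if `A p ≤ C * A q` for all `p ≤ q`, for some `C > 0`. -/
def AlmostIncreasing {ι : Type*} [Preorder ι] (A : ι → ℝ) : Prop :=
  ∃ C > (0 : ℝ), ∀ p q : ι, p ≤ q → A p ≤ C * A q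

/-- The integer iterate `F^⟨n⟩` of a bijection `F`: the `n`-th iterate of `F` for `n ≥ 0`, and the
`(-n)`-th iterate of the inverse of `F` for `n < 0`. -/
noncomputable def intIterate {X : Type*} [Nonempty X] (F : X → X) : ℤ → X → X
  | Int.ofNat n => F^[n]
  | Int.negSucc n => (Function.invFun F)^[n + 1]

/-- `N⁺_{ψ,t}(s) = min {p ∈ ℕ : ψ^⟨p⟩(s) ≥ t}`. -/
noncomputable def NPlus (ψ : ℝ → ℝ) (t s : ℝ) : ℕ :=
  sInf {p : ℕ | t ≤ intIterate ψ (p : ℤ) s}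

/-- `N⁻_{ψ,t}(s) = min {p ∈ ℕ : ψ^⟨-p⟩(s) ≤ t}`. -/
noncomputable def NMinus (ψ : ℝ → ℝ) (t s : ℝ) : ℕ :=
  sInf {p : ℕ | intIterate ψ (-(p : ℤ)) s ≤ t}

/-- For a bijection, `intIterate` is the integer power in the group of permutations. -/
theorem intIterate_eq_zpow {X : Type*} [Nonempty X] (F : X → X) (hF : Function.Bijective F)
    (n : ℤ) (x : X) : intIterate F n x = ((Equiv.ofBijective F hF) ^ n : Equiv.Perm X) x := by
  have hinv : Function.invFun F = ((Equiv.ofBijective F hF)⁻¹ : Equiv.Perm X) := by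
    funext y
    apply hF.1
    rw [Function.invFun_eq (hF.2 y)]
    exact ((Equiv.ofBijective F hF).apply_symm_apply y).symm
  cases n with
  | ofNat n =>
    rw [Int.ofNat_eq_natCast, zpow_natCast, ← Equiv.Perm.iterate_eq_pow]; rfl
  | negSucc n =>
    rw [zpow_negSucc, ← inv_pow, ← Equiv.Perm.iterate_eq_pow, ← hinv]; rfl

/-- Under the standing conditions on `ψ`, it is a bijection of `ℝ`. -/
theorem bijective_of_shift (ψ : ℝ → ℝ) (h1 : ∀ s, s < ψ s) (h2 : Tendsto ψ atBot atBot)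
    (h3 : ∀ s, 0 < deriv ψ s) : Function.Bijective ψ := by
  have hc : Continuous ψ := continuous_iff_continuousAt.2 fun s =>
    (differentiableAt_of_deriv_ne_zero (h3 s).ne').continuousAt
  exact ⟨(strictMono_of_deriv_pos h3).injective,
    hc.surjective (tendsto_atTop_mono (fun s => (h1 s).le) tendsto_id) h2⟩

/-- Under the standing conditions on `ψ`, the minimum defining `N⁺` is over a nonempty set. -/
theorem NPlus_nonempty (ψ : ℝ → ℝ) (h1 : ∀ s, s < ψ s)
    (h3 : ∀ s, 0 < deriv ψ s) (t s : ℝ) :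
    {p : ℕ | t ≤ intIterate ψ (p : ℤ) s}.Nonempty := by
  have hc : Continuous ψ := continuous_iff_continuousAt.2 fun s =>
    (differentiableAt_of_deriv_ne_zero (h3 s).ne').continuousAt
  have hm : Monotone fun n : ℕ => ψ^[n] s := monotone_nat_of_le_succ fun n => by
    rw [Function.iterate_succ_apply']; exact (h1 _).le
  rcases tendsto_atTop_of_monotone hm with h | ⟨l, hl⟩
  · obtain ⟨p, hp⟩ := (h.eventually_ge_atTop t).exists
    exact ⟨p, hp⟩
  · exact absurd (isFixedPt_of_tendsto_iterate hl hc.continuousAt) (h1 l).ne'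

/-- Under the standing conditions on `ψ`, the minimum defining `N⁻` is over a nonempty set. -/
theorem NMinus_nonempty (ψ : ℝ → ℝ) (h1 : ∀ s, s < ψ s) (h2 : Tendsto ψ atBot atBot)
    (h3 : ∀ s, 0 < deriv ψ s) (t s : ℝ) :
    {p : ℕ | intIterate ψ (-(p : ℤ)) s ≤ t}.Nonempty := by
  have hb := bijective_of_shift ψ h1 h2 h3
  have hc : Continuous ψ := continuous_iff_continuousAt.2 fun s =>
    (differentiableAt_of_deriv_ne_zero (h3 s).ne').continuousAt
  have hr : ∀ y, ψ (Function.invFun ψ y) = y := fun y => Function.invFun_eq (hb.2 y)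
  have hm : Antitone fun n : ℕ => (Function.invFun ψ)^[n] s := antitone_nat_of_succ_le fun n => by
    rw [Function.iterate_succ_apply']
    exact ((h1 _).trans_eq (hr _)).le
  rcases tendsto_atTop_of_antitone hm with h | ⟨l, hl⟩
  · obtain ⟨p, hp⟩ := (h.eventually_le_atBot t).exists
    refine ⟨p, ?_⟩
    cases p with
    | zero => exact hp
    | succ p => exact hp
  · have e1 : Tendsto (fun n : ℕ => ψ ((Function.invFun ψ)^[n + 1] s)) atTop (𝓝 (ψ l)) :=
      (hc.tendsto l).comp (hl.comp (tendsto_add_atTop_nat 1))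
    simp only [Function.iterate_succ_apply', hr] at e1
    exact absurd (tendsto_nhds_unique e1 hl) (h1 l).ne'

/-! Take a cutoff θ in the class with values in [0, 1], equal to 0 left of `a` and to 1 right of
`b`, and split χ = (1 - θ)χ + θχ. Since ψ has no fixed point, forward orbits tend to +∞ and backward
orbits to -∞. The first piece vanishes on [b, ∞), so the forward sum f = ∑_{n ≥ 0} ((1 - θ)χ) ∘
ψ^⟨n⟩ satisfies f - f ∘ ψ = (1 - θ)χ. The second vanishes on (-∞, a], so the backward sum k = ∑_{n ≥
1} (θχ) ∘ ψ^⟨-n⟩ satisfies k ∘ ψ - k = θχ. Thus g = f - k is a solution. Monotonicity of ψ makes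
both sums locally finite, and 0 ≤ θ ≤ 1 gives the pointwise bound with constant 1.

It remains to stay inside the class. Products, composition and reciprocals follow from Leibniz
inductions based on log-convexity of `M n / n!`. Instead of Faà di Bruno's formula, one bounds whole
chains such as u_k = F⁽ᵏ⁾ ∘ ψ, with u_k' = u_{k+1} ψ' (`norm_iteratedDeriv_chain_le`). The inverse κ
of ψ solves κ' = (1/ψ') ∘ κ, and `norm_iteratedDeriv_autonomous_le` bounds the solutions of such an
equation. The cutoff is a normalized primitive of a bump, built from a flat function that
nonquasianalyticity provides. -/

/-! ### Log-convex weights -/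

/-- The properties of a weight sequence that are used below: `M n / n!` is logarithmically convex
and nondecreasing from the value `1`, and `M` is stable under derivation. -/
structure IsRegularWeight (M : ℕ → ℝ) : Prop where
  pos : ∀ n, 0 < M n
  zero : M 0 = 1
  one_le_one : 1 ≤ M 1
  logConvex : ∀ n : ℕ, (M (n + 1) / ((n + 1)! : ℝ)) ^ 2 ≤
    M n / (n ! : ℝ) * (M (n + 2) / ((n + 2)! : ℝ))
  derivation : ∃ C > (0 : ℝ), ∃ B > (0 : ℝ), ∀ n, M (n + 1) ≤ C * B ^ n * M n

/-- The sequence `M n / n!`. -/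
noncomputable def reduced (M : ℕ → ℝ) (n : ℕ) : ℝ := M n / (n ! : ℝ)

theorem factorial_mul_reduced (M : ℕ → ℝ) (n : ℕ) : (n ! : ℝ) * reduced M n = M n := by
  unfold reduced
  field_simp

/-- For a positive log-convex sequence, `m (i + j) * m (i + k) ≤ m i * m (i + j + k)`. -/
theorem mul_le_mul_of_logConvex {m : ℕ → ℝ} (hpos : ∀ n, 0 < m n)
    (h : ∀ n, m (n + 1) ^ 2 ≤ m n * m (n + 2)) (i j k : ℕ) :
    m (i + j) * m (i + k) ≤ m i * m (i + j + k) := by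
  -- Log-convexity means that consecutive ratios increase; the induction on `j` multiplies by the
  -- ratio at `i + j` on the left and by the larger one at `i + j + k` on the right.
  have hmono : Monotone fun n => m (n + 1) / m n := monotone_nat_of_le_succ fun n => by
    rw [div_le_div_iff₀ (hpos _) (hpos _)]
    nlinarith [h n]
  induction j with
  | zero => simp
  | succ j ih =>
    have h1 : m (i + j + 1) / m (i + j) ≤ m (i + j + k + 1) / m (i + j + k) :=
      hmono (by omega : i + j ≤ i + j + k)
    calc m (i + (j + 1)) * m (i + k)
        = m (i + j + 1) / m (i + j) * (m (i + j) * m (i + k)) := by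
          rw [← add_assoc]; field_simp [(hpos (i + j)).ne']
      _ ≤ m (i + j + k + 1) / m (i + j + k) * (m i * m (i + j + k)) :=
          mul_le_mul h1 ih (mul_pos (hpos _) (hpos _)).le (div_pos (hpos _) (hpos _)).le
      _ = m i * m (i + (j + 1) + k) := by
          have : i + (j + 1) + k = i + j + k + 1 := by omega
          rw [this]; field_simp [(hpos (i + j + k)).ne']

namespace IsRegularWeight

variable {M : ℕ → ℝ}

theorem reduced_pos (hM : IsRegularWeight M) (n : ℕ) : 0 < reduced M n :=
  div_pos (hM.pos n) (by positivity)

theorem reduced_zero (hM : IsRegularWeight M) : reduced M 0 = 1 := by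
  simp [reduced, hM.zero]

theorem reduced_mul_le (hM : IsRegularWeight M) (p q : ℕ) :
    reduced M p * reduced M q ≤ reduced M (p + q) := by
  have := mul_le_mul_of_logConvex hM.reduced_pos hM.logConvex 0 p q
  simpa [hM.reduced_zero] using this

/-- Log-convexity based at index 1 saves one index over `reduced_mul_le`, which would give `p + q +
2`. The chain estimate needs this saving. -/
theorem reduced_succ_mul_succ_le (hM : IsRegularWeight M) (p q : ℕ) :
    reduced M (p + 1) * reduced M (q + 1) ≤ reduced M 1 * reduced M (p + q + 1) := by
  have := mul_le_mul_of_logConvex hM.reduced_pos hM.logConvex 1 p q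
  rwa [add_comm 1 p, add_comm 1 q, (by omega : p + 1 + q = p + q + 1)] at this

theorem one_le_reduced (hM : IsRegularWeight M) (n : ℕ) : 1 ≤ reduced M n := by
  induction n with
  | zero => rw [hM.reduced_zero]
  | succ n ih =>
    have h1 : 1 ≤ reduced M 1 := by simpa [reduced] using hM.one_le_one
    calc (1 : ℝ) ≤ reduced M n * reduced M 1 := one_le_mul_of_one_le_of_one_le ih h1
      _ ≤ _ := hM.reduced_mul_le n 1

theorem le_succ (hM : IsRegularWeight M) (n : ℕ) : M n ≤ M (n + 1) := by
  rw [← factorial_mul_reduced M n, ← factorial_mul_reduced M (n + 1)]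
  have h1 : 1 ≤ reduced M 1 := hM.one_le_reduced 1
  have h2 : reduced M n ≤ reduced M (n + 1) :=
    (le_mul_of_one_le_right (hM.reduced_pos n).le h1).trans (hM.reduced_mul_le n 1)
  have h3 : (n ! : ℝ) ≤ ((n + 1)! : ℝ) := by exact_mod_cast Nat.factorial_le n.le_succ
  exact mul_le_mul h3 h2 (hM.reduced_pos n).le (by positivity)

end IsRegularWeight

/-! ### Pointwise estimates for chains of functions -/

theorem contDiff_iteratedDeriv {f : ℝ → ℂ} (hf : ContDiff ℝ ∞ f) (n : ℕ) :
    ContDiff ℝ ∞ (iteratedDeriv n f) := by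
  rw [iteratedDeriv_eq_iterate]
  exact hf.iterate_deriv n

theorem norm_iteratedDeriv_mul_le {f g : ℝ → ℂ} (hf : ContDiff ℝ ∞ f) (hg : ContDiff ℝ ∞ g)
    (n : ℕ) (x : ℝ) :
    ‖iteratedDeriv n (f * g) x‖ ≤ ∑ i ∈ Finset.range (n + 1),
      (n.choose i : ℝ) * ‖iteratedDeriv i f x‖ * ‖iteratedDeriv (n - i) g x‖ := by
  rw [iteratedDeriv_mul (hf.contDiffAt.of_le (by exact_mod_cast le_top))
    (hg.contDiffAt.of_le (by exact_mod_cast le_top))]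
  refine (norm_sum_le _ _).trans_eq (Finset.sum_congr rfl fun i _ => ?_)
  simp

/-- The product `(i + 1) ⋯ (i + j)` grows factor by factor when `i` is replaced by `i + k`. This
absorbs the Leibniz coefficients into a single factorial. -/
theorem choose_mul_factorial_mul_factorial_le (i j k : ℕ) :
    (i + j).choose i * (i + k)! * j ! ≤ (i + j + k)! := by
  have h1 : (i + 1).ascFactorial j ≤ (i + k + 1).ascFactorial j := by
    induction j with
    | zero => simp
    | succ j ih =>
      rw [Nat.ascFactorial_succ, Nat.ascFactorial_succ]
      exact Nat.mul_le_mul (by omega) ih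
  have h2 : (i + k)! * (i + k + 1).ascFactorial j = (i + j + k)! := by
    rw [Nat.factorial_mul_ascFactorial]; congr 1; omega
  have h3 : (i + 1).ascFactorial j = j ! * (i + j).choose i := by
    rw [Nat.ascFactorial_eq_factorial_mul_choose, Nat.choose_symm_add]
  calc (i + j).choose i * (i + k)! * j ! = (i + k)! * (i + 1).ascFactorial j := by
        rw [h3]; ring
    _ ≤ (i + k)! * (i + k + 1).ascFactorial j := Nat.mul_le_mul_left _ h1
    _ = _ := h2

/-- Bounds on a chain `(u k)' = u (k + 1) * v`, as for `u k = g⁽ᵏ⁾ ∘ f` and `v = f'`. -/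
theorem norm_iteratedDeriv_chain_le {m : ℕ → ℝ} (hm : ∀ n, 0 < m n)
    (hmm : ∀ p q, m (p + 1) * m (q + 1) ≤ m 1 * m (p + q + 1))
    {u : ℕ → ℝ → ℂ} {v : ℝ → ℂ} (hu : ∀ k, ContDiff ℝ ∞ (u k)) (hv : ContDiff ℝ ∞ v)
    (hd : ∀ k, deriv (u k) = u (k + 1) * v) {x D σ C ρ : ℝ}
    (hD : 0 < D) (hσ : 0 < σ) (hC : 0 < C) (hρ : 0 < ρ)
    (hux : ∀ k, ‖u k x‖ ≤ D * σ ^ k * ((k ! : ℝ) * m k))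
    (hvx : ∀ j, ‖iteratedDeriv j v x‖ ≤ C * ρ ^ j * ((j ! : ℝ) * m (j + 1))) (n k : ℕ) :
    ‖iteratedDeriv n (u k) x‖ ≤
      D * σ ^ k * (ρ + σ * C * m 1) ^ n * (((n + k)! : ℝ) * m (n + k)) := by
  -- With this choice `L - ρ = σ * C * m 1` is the constant that each Leibniz term produces, so the
  -- sum of the terms becomes a telescoping geometric sum.
  set L := ρ + σ * C * m 1 with hL
  have hm1 := hm 1
  have hL0 : 0 < L := by positivity
  induction n using Nat.strong_induction_on generalizing k with
  | _ n ih =>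
  cases n with
  | zero => simpa using hux k
  | succ n =>
    rw [iteratedDeriv_succ', hd]
    refine (norm_iteratedDeriv_mul_le (hu _) hv n x).trans ?_
    have hterm : ∀ i ∈ Finset.range (n + 1),
        (n.choose i : ℝ) * ‖iteratedDeriv i (u (k + 1)) x‖ * ‖iteratedDeriv (n - i) v x‖ ≤
        D * σ ^ k * (((n + 1 + k)! : ℝ) * m (n + 1 + k)) *
          (L ^ i * ρ ^ (n - i) * (L - ρ)) := by
      intro i hi
      obtain ⟨j, rfl⟩ : ∃ j, n = i + j := ⟨n - i, by have := Finset.mem_range.1 hi; omega⟩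
      have hj : i + j - i = j := by omega
      rw [hj]
      have h1 := ih i (by omega) (k + 1)
      have h2 := hvx j
      have h3 : ((i + j).choose i : ℝ) * ((i + (k + 1))! : ℝ) * (j ! : ℝ) ≤
          ((i + j + 1 + k)! : ℝ) := by
        have := choose_mul_factorial_mul_factorial_le i j (k + 1)
        rw [(by omega : i + j + 1 + k = i + j + (k + 1))]
        exact_mod_cast this
      have h4 : m (i + (k + 1)) * m (j + 1) ≤ m 1 * m (i + j + 1 + k) := by
        have := hmm (i + k) j
        rwa [(by omega : i + k + j + 1 = i + j + 1 + k)] at this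
      have hm2 := hm (i + (k + 1))
      have hm3 := hm (j + 1)
      calc ((i + j).choose i : ℝ) * ‖iteratedDeriv i (u (k + 1)) x‖ * ‖iteratedDeriv j v x‖
          ≤ ((i + j).choose i : ℝ) *
            (D * σ ^ (k + 1) * L ^ i * (((i + (k + 1))! : ℝ) * m (i + (k + 1)))) *
            (C * ρ ^ j * ((j ! : ℝ) * m (j + 1))) := by gcongr
        _ = D * σ ^ (k + 1) * L ^ i * C * ρ ^ j *
            ((((i + j).choose i : ℝ) * ((i + (k + 1))! : ℝ) * (j ! : ℝ)) *
              (m (i + (k + 1)) * m (j + 1))) := by ring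
        _ ≤ D * σ ^ (k + 1) * L ^ i * C * ρ ^ j *
            (((i + j + 1 + k)! : ℝ) * (m 1 * m (i + j + 1 + k))) := by gcongr
        _ = _ := by rw [hL]; ring
    refine (Finset.sum_le_sum hterm).trans ?_
    rw [← Finset.mul_sum, ← Finset.sum_mul]
    have hg : (∑ i ∈ Finset.range (n + 1), L ^ i * ρ ^ (n - i)) * (L - ρ) ≤ L ^ (n + 1) := by
      have := geom_sum₂_mul L ρ (n + 1)
      simp only [Nat.add_sub_cancel] at this
      rw [this]
      have : 0 < ρ ^ (n + 1) := by positivity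
      linarith
    have hm2 := hm (n + 1 + k)
    calc _ ≤ D * σ ^ k * (((n + 1 + k)! : ℝ) * m (n + 1 + k)) * L ^ (n + 1) := by gcongr
      _ = _ := by ring

/-! ### Rising factorials and autonomous chains -/

/-- The rising factorial `x (x + 1) ⋯ (x + n - 1)`. -/
def risingFactorial (x : ℝ) (n : ℕ) : ℝ := ∏ i ∈ Finset.range n, (x + i)

theorem risingFactorial_nonneg {x : ℝ} (hx : 0 ≤ x) (n : ℕ) : 0 ≤ risingFactorial x n :=
  Finset.prod_nonneg fun i _ => by positivity

theorem risingFactorial_succ (x : ℝ) (n : ℕ) :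
    risingFactorial x (n + 1) = risingFactorial x n * (x + n) := Finset.prod_range_succ _ _

theorem risingFactorial_succ' (x : ℝ) (n : ℕ) :
    risingFactorial x (n + 1) = x * risingFactorial (x + 1) n := by
  unfold risingFactorial
  rw [Finset.prod_range_succ', mul_comm]
  simp only [Nat.cast_zero, add_zero]
  congr 1
  refine Finset.prod_congr rfl fun i _ => ?_
  push_cast; ring

theorem risingFactorial_le_factorial {x : ℝ} (hx : 0 ≤ x) (hx1 : x ≤ 1) (n : ℕ) :
    risingFactorial x n ≤ n ! := by
  induction n with
  | zero => simp [risingFactorial]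
  | succ n ih =>
    rw [risingFactorial_succ, Nat.factorial_succ, mul_comm (n + 1)]
    push_cast
    exact mul_le_mul ih (by linarith) (by positivity) (by positivity)

/-- The Chu–Vandermonde identity for rising factorials. -/
theorem sum_choose_mul_risingFactorial (x y : ℝ) (n : ℕ) :
    ∑ i ∈ Finset.range (n + 1), (n.choose i : ℝ) * risingFactorial x i * risingFactorial y (n - i) =
      risingFactorial (x + y) n := by
  rw [← Finset.Nat.sum_antidiagonal_eq_sum_range_succ
    (fun i j => (n.choose i : ℝ) * risingFactorial x i * risingFactorial y j)]
  induction n with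
  | zero => simp [risingFactorial]
  | succ n ih =>
    have h := Finset.sum_antidiagonal_choose_succ_mul
      (fun i j => risingFactorial x i * risingFactorial y j) n
    simp only [← mul_assoc] at h
    rw [h, risingFactorial_succ, ← ih, Finset.sum_mul, ← Finset.sum_add_distrib]
    refine Finset.sum_congr rfl fun p hp => ?_
    have hp' : (n : ℝ) = p.1 + p.2 := by exact_mod_cast (Finset.HasAntidiagonal.mem_antidiagonal.1 hp).symm
    have hc : (n.choose p.2 : ℝ) = n.choose p.1 := by
      rw [← Finset.HasAntidiagonal.mem_antidiagonal.1 hp, Nat.choose_symm_add]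
    rw [risingFactorial_succ, risingFactorial_succ, hp', hc]
    ring

/-- Bounds on a chain `(u k)' = u (k + 1) * u 0`, as for `u k = G⁽ᵏ⁾ ∘ κ` where `κ' = G ∘ κ`. -/
theorem norm_iteratedDeriv_autonomous_le {m : ℕ → ℝ} (hm : ∀ n, 0 < m n)
    (hmm : ∀ p q, m p * m q ≤ m (p + q))
    {u : ℕ → ℝ → ℂ} (hu : ∀ k, ContDiff ℝ ∞ (u k))
    (hd : ∀ k, deriv (u k) = u (k + 1) * u 0) {x D σ : ℝ} (hD : 0 < D) (hσ : 0 < σ)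
    (hux : ∀ k, ‖u k x‖ ≤ D * σ ^ k * ((k ! : ℝ) * m k)) (n k : ℕ) :
    ‖iteratedDeriv n (u k) x‖ ≤
      D * σ ^ k * (2 * D * σ) ^ n * ((k ! : ℝ) * risingFactorial ((k + 1) / 2) n * m (n + k)) := by
  -- The bound comes from the model G(y) = 1/(1 - y), κ' = G ∘ κ, κ(0) = 0: there κ = 1 - √(1 - 2t)
  -- and u_k = k! (1 - 2t)^(-(k+1)/2), whose `n`-th derivative at 0 is k! 2ⁿ times the rising
  -- factorial of (k+1)/2. Chu–Vandermonde then closes the induction without loss.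
  induction n using Nat.strong_induction_on generalizing k with
  | _ n ih =>
  cases n with
  | zero => simpa [risingFactorial] using hux k
  | succ n =>
    rw [iteratedDeriv_succ', hd]
    refine (norm_iteratedDeriv_mul_le (hu _) (hu 0) n x).trans ?_
    have hterm : ∀ i ∈ Finset.range (n + 1),
        (n.choose i : ℝ) * ‖iteratedDeriv i (u (k + 1)) x‖ * ‖iteratedDeriv (n - i) (u 0) x‖ ≤
        D * σ ^ (k + 1) * (2 * D * σ) ^ n * D * ((k + 1)! : ℝ) * m (n + 1 + k) *
          ((n.choose i : ℝ) * risingFactorial ((k + 2) / 2) i *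
            risingFactorial (1 / 2) (n - i)) := by
      intro i hi
      obtain ⟨j, rfl⟩ : ∃ j, n = i + j := ⟨n - i, by have := Finset.mem_range.1 hi; omega⟩
      have hj : i + j - i = j := by omega
      rw [hj]
      have h1 := ih i (by omega) (k + 1)
      have h2 := ih j (by omega) 0
      have e1 : (((k + 1 : ℕ) : ℝ) + 1) / 2 = (k + 2) / 2 := by push_cast; ring
      have e2 : (((0 : ℕ) : ℝ) + 1) / 2 = 1 / 2 := by simp
      rw [e1] at h1
      rw [e2] at h2
      simp only [pow_zero, Nat.factorial_zero, Nat.cast_one, one_mul, mul_one, add_zero] at h2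
      have h4 : m (i + (k + 1)) * m j ≤ m (i + j + 1 + k) := by
        have := hmm (i + (k + 1)) j
        rwa [(by omega : i + (k + 1) + j = i + j + 1 + k)] at this
      have hm2 := hm (i + (k + 1))
      have hm3 := hm j
      have hr1 := risingFactorial_nonneg (x := (k + 2) / 2) (by positivity) i
      have hr2 := risingFactorial_nonneg (x := 1 / 2) (by positivity) j
      calc ((i + j).choose i : ℝ) * ‖iteratedDeriv i (u (k + 1)) x‖ * ‖iteratedDeriv j (u 0) x‖
          ≤ ((i + j).choose i : ℝ) * (D * σ ^ (k + 1) * (2 * D * σ) ^ i *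
              (((k + 1)! : ℝ) * risingFactorial ((k + 2) / 2) i * m (i + (k + 1)))) *
            (D * (2 * D * σ) ^ j * (risingFactorial (1 / 2) j * m j)) := by gcongr
        _ = D * σ ^ (k + 1) * (2 * D * σ) ^ (i + j) * D * ((k + 1)! : ℝ) *
            (m (i + (k + 1)) * m j) *
            (((i + j).choose i : ℝ) * risingFactorial ((k + 2) / 2) i *
              risingFactorial (1 / 2) j) := by ring
        _ ≤ _ := by gcongr
    refine (Finset.sum_le_sum hterm).trans_eq ?_
    rw [← Finset.mul_sum, sum_choose_mul_risingFactorial, risingFactorial_succ',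
      Nat.factorial_succ, (by ring : ((k : ℝ) + 2) / 2 + 1 / 2 = (k + 1) / 2 + 1)]
    push_cast
    ring

/-! ### Closure properties of Carleman classes -/

namespace CarlemanClass

variable {M : ℕ → ℝ} {f g : ℝ → ℂ}

theorem add (hM : IsRegularWeight M) (hf : f ∈ CarlemanClass M) (hg : g ∈ CarlemanClass M) :
    f + g ∈ CarlemanClass M := by
  refine ⟨hf.1.add hg.1, fun α β => ?_⟩
  obtain ⟨C, hC, ρ, hρ, h⟩ := hf.2 α β
  obtain ⟨D, hD, σ, hσ, k⟩ := hg.2 α β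
  refine ⟨C + D, by positivity, ρ + σ, by positivity, fun n x hx => ?_⟩
  rw [iteratedDeriv_add (hf.1.contDiffAt.of_le (by exact_mod_cast le_top))
    (hg.1.contDiffAt.of_le (by exact_mod_cast le_top))]
  have hMn := hM.pos n
  calc _ ≤ ‖iteratedDeriv n f x‖ + ‖iteratedDeriv n g x‖ := norm_add_le _ _
    _ ≤ C * ρ ^ n * M n + D * σ ^ n * M n := add_le_add (h n x hx) (k n x hx)
    _ ≤ C * (ρ + σ) ^ n * M n + D * (ρ + σ) ^ n * M n := by
        gcongr <;> linarith
    _ = _ := by ring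

theorem zero (hM : IsRegularWeight M) : (0 : ℝ → ℂ) ∈ CarlemanClass M := by
  refine ⟨contDiff_const, fun α β => ⟨1, one_pos, 1, one_pos, fun n x hx => ?_⟩⟩
  have : iteratedDeriv n (0 : ℝ → ℂ) x = 0 := by
    have := congrFun (iteratedDeriv_eq_iterate (n := n) (f := (0 : ℝ → ℂ))) x
    rw [this]
    have h : ∀ n, deriv^[n] (0 : ℝ → ℂ) = 0 := by
      intro n
      induction n with
      | zero => rfl
      | succ n ih =>
        rw [Function.iterate_succ_apply, show deriv (0 : ℝ → ℂ) = 0 from deriv_zero, ih]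
    rw [h]; rfl
  rw [this, norm_zero]
  have := hM.pos n
  positivity

/-- A function whose derivative lies in the class lies in the class. -/
theorem of_deriv (hM : IsRegularWeight M) (hf : Differentiable ℝ f)
    (hf' : deriv f ∈ CarlemanClass M) : f ∈ CarlemanClass M := by
  refine ⟨contDiff_infty_iff_deriv.2 ⟨hf, hf'.1⟩, fun α β => ?_⟩
  obtain ⟨C, hC, ρ, hρ, h⟩ := hf'.2 α β
  obtain ⟨B, hB⟩ := (isCompact_Icc (a := α) (b := β)).exists_bound_of_continuousOn
    hf.continuous.continuousOn
  refine ⟨|B| + C + 1, by positivity, ρ + 1, by positivity, fun n x hx => ?_⟩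
  cases n with
  | zero =>
    simp only [iteratedDeriv_zero, pow_zero, mul_one, hM.zero]
    linarith [hB x hx, le_abs_self B]
  | succ n =>
    rw [iteratedDeriv_succ']
    have hM0 := hM.pos n
    calc _ ≤ C * ρ ^ n * M n := h n x hx
      _ ≤ C * (ρ + 1) ^ (n + 1) * M (n + 1) := by
        have h1 : ρ ^ n ≤ (ρ + 1) ^ (n + 1) :=
          (pow_le_pow_left₀ hρ.le (by linarith) n).trans
            (pow_le_pow_right₀ (by linarith) n.le_succ)
        have h2 := hM.le_succ n
        gcongr
      _ ≤ _ := by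
        have hM1 := hM.pos (n + 1)
        gcongr
        linarith [abs_nonneg B]

/-- Carleman classes of regular weights are stable under derivation. -/
theorem deriv (hM : IsRegularWeight M) (hf : f ∈ CarlemanClass M) :
    deriv f ∈ CarlemanClass M := by
  refine ⟨(contDiff_infty_iff_deriv.1 hf.1).2, fun α β => ?_⟩
  obtain ⟨C, hC, ρ, hρ, h⟩ := hf.2 α β
  obtain ⟨D, hD, B, hB, k⟩ := hM.derivation
  refine ⟨C * ρ * D, by positivity, ρ * B, by positivity, fun n x hx => ?_⟩
  rw [← iteratedDeriv_succ']
  calc _ ≤ C * ρ ^ (n + 1) * M (n + 1) := h _ x hx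
    _ ≤ C * ρ ^ (n + 1) * (D * B ^ n * M n) := by gcongr; exact k n
    _ = _ := by ring

theorem mul (hM : IsRegularWeight M) (hf : f ∈ CarlemanClass M) (hg : g ∈ CarlemanClass M) :
    f * g ∈ CarlemanClass M := by
  refine ⟨hf.1.mul hg.1, fun α β => ?_⟩
  obtain ⟨C, hC, ρ, hρ, h⟩ := hf.2 α β
  obtain ⟨D, hD, σ, hσ, k⟩ := hg.2 α β
  refine ⟨C * D, by positivity, ρ + σ, by positivity, fun n x hx => ?_⟩
  refine (norm_iteratedDeriv_mul_le hf.1 hg.1 n x).trans ?_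
  have hMn := hM.pos n
  have hterm : ∀ i ∈ Finset.range (n + 1),
      (n.choose i : ℝ) * ‖iteratedDeriv i f x‖ * ‖iteratedDeriv (n - i) g x‖ ≤
        C * D * M n * (ρ ^ i * σ ^ (n - i) * (n.choose i : ℝ)) := by
    intro i hi
    obtain ⟨j, rfl⟩ : ∃ j, n = i + j := ⟨n - i, by have := Finset.mem_range.1 hi; omega⟩
    rw [show i + j - i = j by omega]
    have hi := hM.pos i
    have hj := hM.pos j
    have hmul : M i * M j ≤ M (i + j) := by
      rw [← factorial_mul_reduced M i, ← factorial_mul_reduced M j,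
        ← factorial_mul_reduced M (i + j)]
      have h1 := hM.reduced_mul_le i j
      have h2 : (i ! : ℝ) * (j ! : ℝ) ≤ ((i + j)! : ℝ) := by
        exact_mod_cast Nat.factorial_mul_factorial_dvd_factorial_add i j |> Nat.le_of_dvd
          (Nat.factorial_pos _)
      have h3 := hM.reduced_pos i
      have h4 := hM.reduced_pos j
      calc _ = ((i ! : ℝ) * (j ! : ℝ)) * (reduced M i * reduced M j) := by ring
        _ ≤ _ := by gcongr
    calc _ ≤ ((i + j).choose i : ℝ) * (C * ρ ^ i * M i) * (D * σ ^ j * M j) := by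
          gcongr
          · exact h i x hx
          · exact k j x hx
      _ = C * D * (M i * M j) * (ρ ^ i * σ ^ j * ((i + j).choose i : ℝ)) := by ring
      _ ≤ _ := by gcongr
  refine (Finset.sum_le_sum hterm).trans_eq ?_
  rw [← Finset.mul_sum, ← add_pow]
  ring

theorem const (hM : IsRegularWeight M) (c : ℂ) : (fun _ : ℝ => c) ∈ CarlemanClass M := by
  refine of_deriv hM (differentiable_const c) ?_
  rw [deriv_const']
  exact zero hM

theorem sub (hM : IsRegularWeight M) (hf : f ∈ CarlemanClass M) (hg : g ∈ CarlemanClass M) :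
    f - g ∈ CarlemanClass M := by
  have : f - g = f + (fun _ => (-1 : ℂ)) * g := by
    ext x; simp [sub_eq_add_neg]
  rw [this]
  exact add hM hf (mul hM (const hM _) hg)

theorem sum (hM : IsRegularWeight M) {ι : Type*} (s : Finset ι) {F : ι → ℝ → ℂ}
    (hF : ∀ i ∈ s, F i ∈ CarlemanClass M) : ∑ i ∈ s, F i ∈ CarlemanClass M :=
  Finset.sum_induction F (· ∈ CarlemanClass M) (fun _ _ => add hM) (zero hM) hF

theorem conj (hf : f ∈ CarlemanClass M) : (fun x => star (f x)) ∈ CarlemanClass M := by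
  refine ⟨Complex.conjLIE.contDiff.comp hf.1, fun α β => ?_⟩
  obtain ⟨C, hC, ρ, hρ, h⟩ := hf.2 α β
  refine ⟨C, hC, ρ, hρ, fun n x hx => ?_⟩
  rw [← norm_iteratedFDeriv_eq_norm_iteratedDeriv]
  have := Complex.conjLIE.norm_iteratedFDeriv_comp_left f x n
  rw [norm_iteratedFDeriv_eq_norm_iteratedDeriv (f := f)] at this
  exact this.trans_le (h n x hx)

/-- Membership only depends on germs: a function that agrees near each compact interval with a
member of the class is a member. -/
theorem of_locally (h : ∀ α β : ℝ, ∃ F ∈ CarlemanClass M, Set.EqOn f F (Set.Ioo α β)) :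
    f ∈ CarlemanClass M := by
  have key : ∀ {F : ℝ → ℂ} {α β x : ℝ}, Set.EqOn f F (Set.Ioo α β) → x ∈ Set.Ioo α β →
      f =ᶠ[𝓝 x] F := fun hF hx => hF.eventuallyEq_of_mem (isOpen_Ioo.mem_nhds hx)
  refine ⟨contDiff_iff_contDiffAt.2 fun x => ?_, fun α β => ?_⟩
  · obtain ⟨F, hF, he⟩ := h (x - 1) (x + 1)
    exact hF.1.contDiffAt.congr_of_eventuallyEq (key he ⟨by linarith, by linarith⟩)
  · obtain ⟨F, hF, he⟩ := h (α - 1) (β + 1)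
    obtain ⟨C, hC, ρ, hρ, k⟩ := hF.2 α β
    refine ⟨C, hC, ρ, hρ, fun n x hx => ?_⟩
    rw [(key he ⟨by linarith [hx.1], by linarith [hx.2]⟩).iteratedDeriv_eq]
    exact k n x hx

/-- Writing `(j + 1)! = (j + 1) * j !` and `j + 1 ≤ 2 ^ j` trades the extra factor for a doubled
`ρ`. Keeping the index `j + 1` on the weight gives the form required by the chain estimate. -/
theorem norm_iteratedDeriv_deriv_le (hM : IsRegularWeight M) {C ρ x : ℝ} (hC : 0 < C) (hρ : 0 < ρ)
    (h : ∀ n, ‖iteratedDeriv n f x‖ ≤ C * ρ ^ n * M n) (j : ℕ) :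
    ‖iteratedDeriv j (_root_.deriv f) x‖ ≤
      (C * ρ) * (2 * ρ) ^ j * ((j ! : ℝ) * reduced M (j + 1)) := by
  rw [← iteratedDeriv_succ']
  refine (h (j + 1)).trans ?_
  rw [← factorial_mul_reduced M (j + 1), Nat.factorial_succ]
  have h1 : ((j + 1 : ℕ) : ℝ) ≤ 2 ^ j := by exact_mod_cast Nat.lt_two_pow_self (n := j)
  have h2 := hM.reduced_pos (j + 1)
  calc C * ρ ^ (j + 1) * (((j + 1) * j ! : ℕ) * reduced M (j + 1))
      = C * ρ * ρ ^ j * ((j + 1 : ℕ) : ℝ) * (j ! * reduced M (j + 1)) := by push_cast; ring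
    _ ≤ C * ρ * ρ ^ j * 2 ^ j * (j ! * reduced M (j + 1)) := by gcongr
    _ = _ := by rw [mul_pow]; ring

/-- Members of a chain `(u k)' = u (k + 1) * v'` with `v` in the class and factorial bounds on
compact intervals lie in the class. -/
theorem of_chain (hM : IsRegularWeight M) {u : ℕ → ℝ → ℂ} {v : ℝ → ℂ}
    (hu : ∀ k, ContDiff ℝ ∞ (u k)) (hv : v ∈ CarlemanClass M)
    (hd : ∀ k, _root_.deriv (u k) = u (k + 1) * _root_.deriv v)
    (hb : ∀ α β : ℝ, ∃ D > (0 : ℝ), ∃ σ > (0 : ℝ), ∀ k, ∀ x ∈ Set.Icc α β,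
      ‖u k x‖ ≤ D * σ ^ k * M k) : u 0 ∈ CarlemanClass M := by
  refine ⟨hu 0, fun α β => ?_⟩
  obtain ⟨D, hD, σ, hσ, h⟩ := hb α β
  obtain ⟨C, hC, ρ, hρ, k⟩ := hv.2 α β
  have hm1 := hM.reduced_pos 1
  refine ⟨D, hD, 2 * ρ + σ * (C * ρ) * reduced M 1, by positivity, fun n x hx => ?_⟩
  have := norm_iteratedDeriv_chain_le hM.reduced_pos hM.reduced_succ_mul_succ_le hu
    (contDiff_infty_iff_deriv.1 hv.1).2 hd hD hσ (by positivity : 0 < C * ρ)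
    (by positivity : 0 < 2 * ρ) (x := x)
    (fun k => by rw [factorial_mul_reduced]; exact h k x hx)
    (norm_iteratedDeriv_deriv_le hM hC hρ fun n => k n x hx) n 0
  simpa [factorial_mul_reduced] using this

theorem contDiff_re {ψ : ℝ → ℝ} (hψ : (fun s => (ψ s : ℂ)) ∈ CarlemanClass M) :
    ContDiff ℝ ∞ ψ := by
  have := Complex.reCLM.contDiff.comp hψ.1
  simpa [Function.comp_def] using this

theorem deriv_comp_ofReal {F : ℝ → ℂ} {ψ : ℝ → ℝ} (hF : Differentiable ℝ F)
    (hψ : Differentiable ℝ ψ) :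
    _root_.deriv (F ∘ ψ) = (_root_.deriv F ∘ ψ) * _root_.deriv (fun s => (ψ s : ℂ)) := by
  ext x
  have h1 := ((hF (ψ x)).hasDerivAt.scomp x (hψ x).hasDerivAt).deriv
  have h2 := (hψ x).hasDerivAt.ofReal_comp.deriv
  simp only [Pi.mul_apply, h1, h2, Function.comp_apply, Complex.real_smul]
  ring

/-- Carleman classes of regular weights are stable under composition. -/
theorem comp (hM : IsRegularWeight M) {F : ℝ → ℂ} {ψ : ℝ → ℝ} (hF : F ∈ CarlemanClass M)
    (hψ : (fun s => (ψ s : ℂ)) ∈ CarlemanClass M) : F ∘ ψ ∈ CarlemanClass M := by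
  have hψr := contDiff_re hψ
  refine of_chain hM (u := fun k => iteratedDeriv k F ∘ ψ)
    (fun k => (contDiff_iteratedDeriv hF.1 k).comp hψr) hψ (fun k => ?_) (fun α β => ?_)
  · rw [deriv_comp_ofReal ((contDiff_iteratedDeriv hF.1 k).differentiable (by simp))
      (hψr.differentiable (by simp)), iteratedDeriv_succ]
  · obtain ⟨B, hB⟩ := (isCompact_Icc (a := α) (b := β)).exists_bound_of_continuousOn
      hψr.continuous.continuousOn
    obtain ⟨C, hC, ρ, hρ, h⟩ := hF.2 (-B) B
    exact ⟨C, hC, ρ, hρ, fun k x hx => h k _ (abs_le.1 (hB x hx))⟩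

/-- Carleman classes of regular weights are stable under reciprocals of nonvanishing functions. -/
theorem inv (hM : IsRegularWeight M) {w : ℝ → ℂ} (hw : w ∈ CarlemanClass M) (h0 : ∀ x, w x ≠ 0) :
    (fun x => (w x)⁻¹) ∈ CarlemanClass M := by
  have hwi : ContDiff ℝ ∞ fun x => (w x)⁻¹ := hw.1.inv h0
  -- The chain consists of the derivatives of y ↦ 1/y evaluated at `w`; their factorial growth is
  -- admissible because `k ! ≤ M k`.
  have := of_chain hM (u := fun k x => (-1) ^ k * (k ! : ℂ) * (w x)⁻¹ ^ (k + 1)) (v := w)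
    (fun k => contDiff_const.mul (hwi.pow _)) hw (fun k => ?_) (fun α β => ?_)
  · simpa using this
  · ext x
    have hd := (hw.1.differentiable (by simp) x).hasDerivAt
    have h1 := ((hd.fun_inv (h0 x)).fun_pow (k + 1)).const_mul ((-1) ^ k * (k ! : ℂ))
    rw [h1.deriv, Pi.mul_apply, Nat.factorial_succ]
    have := h0 x
    simp only [Nat.add_sub_cancel, inv_pow, pow_succ, Nat.cast_mul]
    push_cast
    field_simp
  · obtain ⟨B, hB⟩ := (isCompact_Icc (a := α) (b := β)).exists_bound_of_continuousOn
      hwi.continuous.continuousOn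
    have hB1 : 0 < |B| + 1 := by positivity
    refine ⟨|B| + 1, hB1, |B| + 1, hB1, fun k x hx => ?_⟩
    have h1 : ‖(w x)⁻¹‖ ≤ |B| + 1 := by linarith [hB x hx, le_abs_self B]
    rw [← factorial_mul_reduced M k]
    have h2 := hM.one_le_reduced k
    calc ‖(-1 : ℂ) ^ k * (k ! : ℂ) * (w x)⁻¹ ^ (k + 1)‖
        = k ! * ‖(w x)⁻¹‖ ^ (k + 1) := by
          simp only [norm_mul, norm_pow, norm_neg, norm_one, one_pow, one_mul, Complex.norm_natCast]
      _ ≤ k ! * (|B| + 1) ^ (k + 1) := by gcongr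
      _ = (|B| + 1) * (|B| + 1) ^ k * (k ! * 1) := by ring
      _ ≤ _ := by gcongr

/-- A solution of the autonomous equation `κ' = G ∘ κ` with `G` in the class is in the class. -/
theorem of_autonomous (hM : IsRegularWeight M) {G : ℝ → ℂ} {κ : ℝ → ℝ} (hG : G ∈ CarlemanClass M)
    (hκ : Differentiable ℝ κ) (h : _root_.deriv (fun s => (κ s : ℂ)) = G ∘ κ) :
    (fun s => (κ s : ℂ)) ∈ CarlemanClass M := by
  have hκc : Differentiable ℝ fun s => (κ s : ℂ) := fun x =>
    (hκ x).hasDerivAt.ofReal_comp.differentiableAt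
  -- Bootstrap: if κ is Cⁿ, so is κ' = G ∘ κ, hence κ is Cⁿ⁺¹.
  have hn : ∀ n : ℕ, ContDiff ℝ n κ := by
    intro n
    induction n with
    | zero => exact contDiff_zero.2 hκ.continuous
    | succ n ih =>
      have h1 : ContDiff ℝ ((n : ℕ) + 1) fun s => (κ s : ℂ) := by
        refine contDiff_succ_iff_deriv.2 ⟨hκc, by simp, ?_⟩
        rw [h]
        exact (hG.1.of_le (by exact_mod_cast le_top)).comp ih
      simpa [Function.comp_def] using Complex.reCLM.contDiff.comp h1
  have hκs : ContDiff ℝ ∞ κ := contDiff_infty.2 hn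
  refine of_deriv hM hκc ?_
  rw [h]
  -- The estimate is made for κ' = G ∘ κ, the term u_0 of the chain u_k = G⁽ᵏ⁾ ∘ κ; since κ' = u_0,
  -- the chain closes up as u_k' = u_{k+1} u_0.
  have hu : ∀ k, ContDiff ℝ ∞ (iteratedDeriv k G ∘ κ) := fun k =>
    (contDiff_iteratedDeriv hG.1 k).comp hκs
  refine ⟨hu 0, fun α β => ?_⟩
  obtain ⟨B, hB⟩ := (isCompact_Icc (a := α) (b := β)).exists_bound_of_continuousOn
    hκs.continuous.continuousOn
  obtain ⟨D, hD, σ, hσ, k⟩ := hG.2 (-B) B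
  refine ⟨D, hD, 2 * D * σ, by positivity, fun n x hx => ?_⟩
  have key := norm_iteratedDeriv_autonomous_le hM.reduced_pos hM.reduced_mul_le hu
    (fun k => ?_) hD hσ (x := x) (fun j => ?_) n 0
  · simp only [iteratedDeriv_zero, pow_zero, mul_one, Nat.factorial_zero, Nat.cast_one, one_mul,
      CharP.cast_eq_zero, zero_add, add_zero] at key
    refine key.trans ?_
    rw [← factorial_mul_reduced M n]
    have h1 := hM.reduced_pos n
    have h2 := risingFactorial_le_factorial (x := 1 / 2) (by norm_num) (by norm_num) n
    gcongr
  · rw [deriv_comp_ofReal ((contDiff_iteratedDeriv hG.1 k).differentiable (by simp)) hκ,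
      h, iteratedDeriv_succ, iteratedDeriv_zero]
  · rw [factorial_mul_reduced]
    exact k j _ (abs_le.1 (hB x hx))

/-- The inverse of an increasing diffeomorphism in the class lies in the class. -/
theorem inverse (hM : IsRegularWeight M) {ψ κ : ℝ → ℝ} (hψ : (fun s => (ψ s : ℂ)) ∈ CarlemanClass M)
    (hpos : ∀ s, 0 < _root_.deriv ψ s) (hr : ∀ s, ψ (κ s) = s) :
    (fun s => (κ s : ℂ)) ∈ CarlemanClass M := by
  have hψd : Differentiable ℝ ψ := (contDiff_re hψ).differentiable (by simp)
  have hκc : Continuous κ := by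
    have := ((strictMono_of_deriv_pos hpos).orderIsoOfRightInverse ψ κ hr).symm.continuous
    exact this
  have hκd : ∀ x, HasDerivAt κ (_root_.deriv ψ (κ x))⁻¹ x := fun x =>
    (hψd (κ x)).hasDerivAt.of_local_left_inverse hκc.continuousAt (hpos _).ne'
      (Eventually.of_forall hr)
  have hdc : ∀ s, _root_.deriv (fun s => (ψ s : ℂ)) s = ((_root_.deriv ψ s : ℝ) : ℂ) := fun s =>
    (hψd s).hasDerivAt.ofReal_comp.deriv
  refine of_autonomous hM (inv hM (deriv hM hψ) fun s => ?_)
    (fun x => (hκd x).differentiableAt) ?_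
  · rw [hdc]
    exact_mod_cast (hpos s).ne'
  · ext x
    rw [(hκd x).ofReal_comp.deriv, Function.comp_apply, hdc, Complex.ofReal_inv]

theorem affine (hM : IsRegularWeight M) (c d : ℝ) :
    (fun s : ℝ => ((c * s + d : ℝ) : ℂ)) ∈ CarlemanClass M := by
  have h : ∀ x : ℝ, HasDerivAt (fun s : ℝ => ((c * s + d : ℝ) : ℂ)) (c : ℂ) x := fun x => by
    simpa using (((hasDerivAt_id x).const_mul c).add_const d).ofReal_comp
  refine of_deriv hM (fun x => (h x).differentiableAt) ?_
  rw [funext fun x => (h x).deriv]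
  exact const hM _

end CarlemanClass

/-! ### Cutoff functions -/

/-- The function that vanishes on `(-∞, x₀]` and equals `f` on `(x₀, ∞)`. -/
noncomputable def truncateLeft (x₀ : ℝ) (f : ℝ → ℂ) (x : ℝ) : ℂ := if x ≤ x₀ then 0 else f x

/-- Only `x₀` is delicate: there the increment of the truncation is dominated by that of `f`, which
is o(y - x₀) because `f` and its derivative vanish at `x₀`. -/
theorem hasDerivAt_truncateLeft {f : ℝ → ℂ} {x₀ : ℝ} (hf : Differentiable ℝ f) (h0 : f x₀ = 0)
    (h1 : deriv f x₀ = 0) (x : ℝ) :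
    HasDerivAt (truncateLeft x₀ f) (truncateLeft x₀ (deriv f) x) x := by
  rcases lt_trichotomy x x₀ with h | rfl | h
  · have : truncateLeft x₀ f =ᶠ[𝓝 x] fun _ => 0 := by
      filter_upwards [eventually_lt_nhds h] with y hy
      simp [truncateLeft, hy.le]
    simpa [truncateLeft, h.le] using (hasDerivAt_const x (0 : ℂ)).congr_of_eventuallyEq this
  · have := (hf x).hasDerivAt
    rw [h1, hasDerivAt_iff_isLittleO] at this
    simp only [truncateLeft, le_refl, if_true]
    rw [hasDerivAt_iff_isLittleO]
    refine (Asymptotics.IsBigO.of_bound 1 (Eventually.of_forall fun y => ?_)).trans_isLittleO this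
    by_cases hy : y ≤ x
    · simp only [truncateLeft, hy, le_refl, if_true]
      simp only [sub_zero, smul_zero, norm_zero, one_mul]
      positivity
    · simp [truncateLeft, hy, h0]
  · have : truncateLeft x₀ f =ᶠ[𝓝 x] f := by
      filter_upwards [eventually_gt_nhds h] with y hy
      simp [truncateLeft, not_le.2 hy]
    simpa [truncateLeft, not_le.2 h] using (hf x).hasDerivAt.congr_of_eventuallyEq this

theorem iteratedDeriv_truncateLeft {f : ℝ → ℂ} {x₀ : ℝ} (hf : ContDiff ℝ ∞ f)
    (h0 : ∀ n, iteratedDeriv n f x₀ = 0) (n : ℕ) :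
    iteratedDeriv n (truncateLeft x₀ f) = truncateLeft x₀ (iteratedDeriv n f) := by
  induction n with
  | zero => simp
  | succ n ih =>
    rw [iteratedDeriv_succ, ih, iteratedDeriv_succ]
    ext x
    exact (hasDerivAt_truncateLeft ((contDiff_iteratedDeriv hf n).differentiable (by simp)) (h0 n)
      (by rw [← iteratedDeriv_succ]; exact h0 (n + 1)) x).deriv

namespace CarlemanClass

variable {M : ℕ → ℝ}

theorem truncateLeft (hM : IsRegularWeight M) {f : ℝ → ℂ} {x₀ : ℝ} (hf : f ∈ CarlemanClass M)
    (h0 : ∀ n, iteratedDeriv n f x₀ = 0) : truncateLeft x₀ f ∈ CarlemanClass M := by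
  refine ⟨contDiff_of_differentiable_iteratedDeriv fun n _ => ?_, fun α β => ?_⟩
  · rw [iteratedDeriv_truncateLeft hf.1 h0]
    exact fun x => (hasDerivAt_truncateLeft
      ((contDiff_iteratedDeriv hf.1 n).differentiable (by simp)) (h0 n)
      (by rw [← iteratedDeriv_succ]; exact h0 (n + 1)) x).differentiableAt
  · obtain ⟨C, hC, ρ, hρ, h⟩ := hf.2 α β
    refine ⟨C, hC, ρ, hρ, fun n x hx => ?_⟩
    rw [iteratedDeriv_truncateLeft hf.1 h0, _root_.truncateLeft]
    split_ifs
    · have := hM.pos n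
      rw [norm_zero]
      positivity
    · exact h n x hx

theorem comp_affine (hM : IsRegularWeight M) {f : ℝ → ℂ} (hf : f ∈ CarlemanClass M) (c d : ℝ) :
    (fun s => f (c * s + d)) ∈ CarlemanClass M :=
  comp hM hf (affine hM c d)

/-- In a nonquasianalytic class some function vanishes on a left half-line but not at some point. -/
theorem exists_eq_zero_of_le (hM : IsRegularWeight M) (hq : Nonquasianalytic M) :
    ∃ h ∈ CarlemanClass M, ∃ x₀ x₁ : ℝ, (∀ x ≤ x₀, h x = 0) ∧ h x₁ ≠ 0 := by
  obtain ⟨f, hf, ⟨x₁, h1⟩, x₀, h0⟩ := hq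
  have hne : x₁ ≠ x₀ := fun h => h1 (by rw [h]; simpa using h0 0)
  rcases hne.lt_or_gt with h | h
  · refine ⟨_, truncateLeft hM (x₀ := -x₀) (comp_affine hM hf (-1) 0) (fun n => ?_), -x₀, -x₁,
      fun x hx => by simp [_root_.truncateLeft, hx], ?_⟩
    · have := iteratedDeriv_comp_neg n f (-x₀)
      simp only [neg_neg, h0, smul_zero] at this
      simpa using this
    · simpa [_root_.truncateLeft, h] using h1
  · exact ⟨_, truncateLeft hM hf h0, x₀, x₁, fun x hx => by simp [_root_.truncateLeft, hx],
      by simpa [_root_.truncateLeft, h] using h1⟩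

/-- Nonquasianalytic classes contain nonnegative bump functions. -/
theorem exists_bump (hM : IsRegularWeight M) (hq : Nonquasianalytic M) :
    ∃ p : ℝ → ℝ, (fun s => (p s : ℂ)) ∈ CarlemanClass M ∧ (∀ s, 0 ≤ p s) ∧
      ∃ y z w : ℝ, y < z ∧ (∀ s ≤ y, p s = 0) ∧ (∀ s, z ≤ s → p s = 0) ∧
        w ∈ Set.Icc y z ∧ p w ≠ 0 := by
  obtain ⟨h, hh, x₀, x₁, h0, h1⟩ := exists_eq_zero_of_le hM hq
  have hlt : x₀ < x₁ := not_le.1 fun hle => h1 (h0 _ hle)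
  -- Multiplying by the reflection about `x₁` forces vanishing beyond `2 * x₁ - x₀` too, while the
  -- value at `x₁` stays nonzero. The squared modulus is `h` times its conjugate, hence in the
  -- class.
  refine ⟨fun s => Complex.normSq (h s) * Complex.normSq (h (-1 * s + 2 * x₁)), ?_,
    fun s => mul_nonneg (Complex.normSq_nonneg _) (Complex.normSq_nonneg _),
    x₀, 2 * x₁ - x₀, x₁, by linarith, fun s hs => by simp [h0 s hs], fun s hs => ?_,
    ⟨by linarith, by linarith⟩, ?_⟩
  · have h2 : (fun s => h s * star (h s)) ∈ CarlemanClass M := mul hM hh (conj hh)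
    have h3 := mul hM h2 (comp_affine hM h2 (-1) (2 * x₁))
    convert h3 using 1
    ext s
    simp [Complex.mul_conj]
  · have : h (-1 * s + 2 * x₁) = 0 := h0 _ (by linarith)
    simp only [this, map_zero, mul_zero]
  · have : (-1) * x₁ + 2 * x₁ = x₁ := by ring
    simp only [this]
    exact mul_ne_zero (by simpa using h1) (by simpa using h1)

/-- Nonquasianalytic classes contain cutoff functions. -/
theorem exists_cutoff (hM : IsRegularWeight M) (hq : Nonquasianalytic M) {a b : ℝ} (hab : a < b) :
    ∃ θ : ℝ → ℝ, (fun s => (θ s : ℂ)) ∈ CarlemanClass M ∧ (∀ s, θ s ∈ Set.Icc 0 1) ∧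
      (∀ s ≤ a, θ s = 0) ∧ ∀ s, b ≤ s → θ s = 1 := by
  obtain ⟨p, hp, hp0, y, z, w, hyz, hy, hz, hw, hpw⟩ := exists_bump hM hq
  have hc : Continuous p := (contDiff_re hp).continuous
  set P : ℝ → ℝ := fun x => ∫ t in y..x, p t with hP
  have hi : ∀ u v, IntervalIntegrable p MeasureTheory.volume u v := fun u v =>
    hc.intervalIntegrable u v
  have hPd : ∀ x, HasDerivAt P (p x) x := fun x => hc.integral_hasStrictDerivAt y x |>.hasDerivAt
  have hmono : Monotone P := monotone_of_deriv_nonneg (fun x => (hPd x).differentiableAt)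
    fun x => by rw [(hPd x).deriv]; exact hp0 x
  have hPy : ∀ x ≤ y, P x = 0 := fun x hx => by
    rw [hP]
    refine (intervalIntegral.integral_congr (g := fun _ => (0 : ℝ)) fun t ht => ?_).trans (by simp)
    rw [Set.uIcc_of_ge hx] at ht
    exact hy t ht.2
  have hPz : ∀ x, z ≤ x → P x = P z := fun x hx => by
    have h1 : P z + ∫ t in z..x, p t = P x :=
      intervalIntegral.integral_add_adjacent_intervals (hi _ _) (hi _ _)
    have h2 : ∫ t in z..x, p t = 0 := by
      refine (intervalIntegral.integral_congr (g := fun _ => (0 : ℝ)) fun t ht => ?_).trans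
        (by simp)
      rw [Set.uIcc_of_le hx] at ht
      exact hz t ht.1
    linarith
  have hI : 0 < P z := intervalIntegral.integral_pos hyz hc.continuousOn (fun x _ => hp0 x)
    ⟨w, hw, (hp0 w).lt_of_ne' hpw⟩
  have hPc : (fun s => (P s : ℂ)) ∈ CarlemanClass M := by
    refine of_deriv hM (fun x => (hPd x).ofReal_comp.differentiableAt) ?_
    rw [funext fun x => (hPd x).ofReal_comp.deriv]
    exact hp
  have hba : 0 < b - a := sub_pos.2 hab
  have hzy : 0 < z - y := sub_pos.2 hyz
  -- The affine map `s ↦ c * s + (y - c * a)` sends `a` to `y` and `b` to `z`, so it moves the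
  -- transition zone of the primitive `P` to `[a, b]`.
  set c := (z - y) / (b - a) with hcdef
  have hc0 : 0 < c := by positivity
  have hcb : c * (b - a) = z - y := by rw [hcdef]; field_simp
  refine ⟨fun s => P (c * s + (y - c * a)) / P z, ?_, fun s => ⟨?_, ?_⟩, fun s hs => ?_,
    fun s hs => ?_⟩
  · have h1 := mul hM (comp_affine hM hPc c (y - c * a)) (const hM ((P z : ℂ)⁻¹))
    convert h1 using 1
    ext s
    simp [div_eq_mul_inv]
  · refine div_nonneg ?_ hI.le
    rcases le_total (c * s + (y - c * a)) y with h | h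
    · rw [hPy _ h]
    · rw [← hPy y le_rfl]; exact hmono h
  · refine (div_le_one hI).2 ?_
    rcases le_total (c * s + (y - c * a)) z with h | h
    · exact hmono h
    · rw [hPz _ h]
  · have : c * s + (y - c * a) ≤ y := by nlinarith
    simp [hPy _ this]
  · have : z ≤ c * s + (y - c * a) := by nlinarith
    simp [hPz _ this, hI.ne']

end CarlemanClass

/-! ### The cohomological equation -/

theorem CarlemanClass.iterate {M : ℕ → ℝ} (hM : IsRegularWeight M) {T : ℝ → ℝ}
    (hT : (fun s => (T s : ℂ)) ∈ CarlemanClass M) (n : ℕ) :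
    (fun s => (T^[n] s : ℂ)) ∈ CarlemanClass M := by
  induction n with
  | zero => simpa using affine hM 1 0
  | succ n ih => exact comp hM ih hT

/-- A locally finite sum of the functions `F ∘ T^[n]` lies in the class. -/
theorem CarlemanClass.exists_sum_iterate {M : ℕ → ℝ} (hM : IsRegularWeight M) {T : ℝ → ℝ}
    (hT : (fun s => (T s : ℂ)) ∈ CarlemanClass M) {F : ℝ → ℂ} (hF : F ∈ CarlemanClass M)
    (h : ∀ α β : ℝ, ∃ N : ℕ, ∀ n ≥ N, ∀ s ∈ Set.Ioo α β, F (T^[n] s) = 0) :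
    ∃ g ∈ CarlemanClass M, ∀ s, ∀ N : ℕ, (∀ n ≥ N, F (T^[n] s) = 0) →
      g s = ∑ n ∈ Finset.range N, F (T^[n] s) := by
  have key : ∀ s, ∀ N : ℕ, (∀ n ≥ N, F (T^[n] s) = 0) →
      ∑' n, F (T^[n] s) = ∑ n ∈ Finset.range N, F (T^[n] s) := fun s N hN =>
    tsum_eq_sum fun n hn => hN n (by simpa using hn)
  refine ⟨fun s => ∑' n, F (T^[n] s), of_locally fun α β => ?_, key⟩
  obtain ⟨N, hN⟩ := h α β
  refine ⟨∑ n ∈ Finset.range N, F ∘ T^[n], sum hM _ fun n _ => comp hM hF (iterate hM hT n), ?_⟩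
  intro s hs
  simp only [Finset.sum_apply, Function.comp_apply]
  exact key s N fun n hn => hN n hn s hs

/-! ### Integer orbits and their entry times -/

theorem intIterate_neg_natCast {X : Type*} [Nonempty X] (F : X → X) (n : ℕ) :
    intIterate F (-(n : ℤ)) = (Function.invFun F)^[n] := by
  cases n <;> rfl

/-- Splitting at 0 matches the two one-sided series: the backward one starts at index -1, hence the
shift `n + 1`. -/
theorem sum_Icc_neg_eq_sum_range (f : ℤ → ℝ) (p q : ℕ) :
    ∑ n ∈ Finset.Icc (-(p : ℤ)) ((q : ℤ) - 1), f n =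
      ∑ n ∈ Finset.range q, f n + ∑ n ∈ Finset.range p, f (-((n + 1 : ℕ) : ℤ)) := by
  have h1 : Function.Injective fun n : ℕ => (n : ℤ) := Nat.cast_injective
  have h2 : Function.Injective fun n : ℕ => -((n + 1 : ℕ) : ℤ) := fun m n h => by
    simp only [neg_inj] at h
    omega
  have e1 := Finset.sum_map (Finset.range q) ⟨_, h1⟩ f
  have e2 := Finset.sum_map (Finset.range p) ⟨_, h2⟩ f
  simp only [Function.Embedding.coeFn_mk] at e1 e2
  rw [← e1, ← e2, ← Finset.sum_union]
  · refine Finset.sum_congr ?_ fun _ _ => rfl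
    ext x
    simp only [Finset.mem_Icc, Finset.mem_union, Finset.mem_map, Finset.mem_range,
      Function.Embedding.coeFn_mk]
    constructor
    · rintro ⟨hx1, hx2⟩
      rcases le_or_gt 0 x with hx | hx
      · exact Or.inl ⟨x.toNat, by omega, by omega⟩
      · exact Or.inr ⟨(-x - 1).toNat, by omega, by omega⟩
    · rintro (⟨y, hy, rfl⟩ | ⟨y, hy, rfl⟩) <;> constructor <;> omega
  · rw [Finset.disjoint_left]
    intro x hx hx'
    simp only [Finset.mem_map, Function.Embedding.coeFn_mk] at hx hx'
    obtain ⟨y, _, rfl⟩ := hx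
    obtain ⟨z, _, hz⟩ := hx'
    omega

/-- Orbits increase, so an orbit that has reached `t` stays above it. Nonemptiness matters because
`sInf ∅ = 0`. -/
theorem le_iterate_of_NPlus_le {ψ : ℝ → ℝ} (h1 : ∀ s, s < ψ s) (h3 : ∀ s, 0 < deriv ψ s)
    {t s : ℝ} {n : ℕ} (hn : NPlus ψ t s ≤ n) : t ≤ ψ^[n] s := by
  have h : t ≤ ψ^[NPlus ψ t s] s := Nat.sInf_mem (NPlus_nonempty ψ h1 h3 t s)
  have hm : Monotone fun n : ℕ => ψ^[n] s := monotone_nat_of_le_succ fun n => by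
    rw [Function.iterate_succ_apply']; exact (h1 _).le
  exact h.trans (hm hn)

theorem iterate_invFun_le_of_NMinus_le {ψ : ℝ → ℝ} (h1 : ∀ s, s < ψ s)
    (h2 : Tendsto ψ atBot atBot) (h3 : ∀ s, 0 < deriv ψ s)
    {t s : ℝ} {n : ℕ} (hn : NMinus ψ t s ≤ n) : (Function.invFun ψ)^[n] s ≤ t := by
  have h : intIterate ψ (-(NMinus ψ t s : ℤ)) s ≤ t :=
    Nat.sInf_mem (NMinus_nonempty ψ h1 h2 h3 t s)
  rw [intIterate_neg_natCast] at h
  have hr : ∀ y, ψ (Function.invFun ψ y) = y := fun y =>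
    Function.invFun_eq ((bijective_of_shift ψ h1 h2 h3).2 y)
  have hm : Antitone fun n : ℕ => (Function.invFun ψ)^[n] s := antitone_nat_of_succ_le fun n => by
    rw [Function.iterate_succ_apply']
    exact ((h1 _).trans_eq (hr _)).le
  exact (hm hn).trans h

/-- Raising the bound to the power `n` gives `M (n + 1) ≤ (n + 1) Bⁿ M n`, and `n + 1 ≤ 2 ^ n`. The
root condition says nothing at `n = 0`; the constant `M 1` covers that case. -/
theorem isRegularWeight_of_bddAbove {M : ℕ → ℝ} (hMpos : ∀ n, 0 < M n)
    (hM2 : 1 = M 0 ∧ M 0 ≤ M 1)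
    (hM3 : ∀ n : ℕ, (M (n + 1) / ((n + 1)! : ℝ)) ^ 2 ≤
      M n / (n ! : ℝ) * (M (n + 2) / ((n + 2)! : ℝ)))
    (hM4 : BddAbove (Set.range fun n : ℕ+ =>
      (M ((n : ℕ) + 1) / ((((n : ℕ) : ℝ) + 1) * M n)) ^ (1 / ((n : ℕ) : ℝ)))) :
    IsRegularWeight M := by
  refine ⟨hMpos, hM2.1.symm, by linarith [hM2.1, hM2.2], hM3, ?_⟩
  obtain ⟨B, hB⟩ := hM4
  refine ⟨M 1, hMpos 1, 2 * (|B| + 1), by positivity, fun n => ?_⟩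
  rcases Nat.eq_zero_or_pos n with rfl | hn
  · simp [← hM2.1]
  have h1 := hB (Set.mem_range_self (⟨n, hn⟩ : ℕ+))
  simp only [PNat.mk_coe, one_div] at h1
  have hMn := hMpos n
  have hMn1 := hMpos (n + 1)
  have h0 : 0 ≤ M (n + 1) / (((n : ℝ) + 1) * M n) := by positivity
  have h2 : M (n + 1) / (((n : ℝ) + 1) * M n) ≤ (|B| + 1) ^ n := by
    rw [← Real.rpow_inv_natCast_pow h0 hn.ne']
    exact pow_le_pow_left₀ (Real.rpow_nonneg h0 _) (by linarith [le_abs_self B]) n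
  rw [div_le_iff₀ (by positivity)] at h2
  have h3 : (n : ℝ) + 1 ≤ 2 ^ n := by exact_mod_cast Nat.lt_two_pow_self (n := n)
  have h4 : 1 ≤ M 1 := by linarith [hM2.1, hM2.2]
  calc M (n + 1) ≤ (|B| + 1) ^ n * (((n : ℝ) + 1) * M n) := h2
    _ ≤ (|B| + 1) ^ n * (2 ^ n * M n) := by gcongr
    _ = 1 * (2 * (|B| + 1)) ^ n * M n := by rw [mul_pow]; ring
    _ ≤ _ := by gcongr

theorem mainTheorem2
    (a b : ℝ) (hab : a < b)
    (M : ℕ → ℝ) (hMpos : ∀ n, 0 < M n)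
    (hMnq : Nonquasianalytic M)
    (hM1 : AlmostIncreasing fun n : ℕ+ => (M n / ((n : ℕ)! : ℝ)) ^ (1 / ((n : ℕ) : ℝ)))
    (hM2 : 1 = M 0 ∧ M 0 ≤ M 1)
    (hM3 : ∀ n : ℕ, (M (n + 1) / ((n + 1)! : ℝ)) ^ 2 ≤
      M n / (n ! : ℝ) * (M (n + 2) / ((n + 2)! : ℝ)))
    (hM4 : BddAbove (Set.range fun n : ℕ+ =>
      (M ((n : ℕ) + 1) / ((((n : ℕ) : ℝ) + 1) * M n)) ^ (1 / ((n : ℕ) : ℝ))))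
    (hM5 : 0 < liminf (fun n : ℕ => (((M n / (n ! : ℝ)) ^ (1 / (n : ℝ)) : ℝ) : EReal)) atTop)
    (ψ : ℝ → ℝ) (hψ : (fun s => (ψ s : ℂ)) ∈ CarlemanClass M)
    (hψ1 : ∀ s, s < ψ s)
    (hψ2 : Tendsto ψ atBot atBot)
    (hψ3 : ∀ s, 0 < deriv ψ s)
    (χ : ℝ → ℂ) (hχ : χ ∈ CarlemanClass M) :
    ∃ g ∈ CarlemanClass M, g - g ∘ ψ = χ ∧
      ∀ s : ℝ, ‖g s‖ ≤
        ∑ n ∈ Finset.Icc (-(NMinus ψ a s : ℤ)) ((NPlus ψ b s : ℤ) - 1),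
          ‖χ (intIterate ψ n s)‖ := by
  have hM := isRegularWeight_of_bddAbove hMpos hM2 hM3 hM4
  obtain ⟨θ, hθ, hθ01, hθa, hθb⟩ := CarlemanClass.exists_cutoff hM hMnq hab
  have hbij := bijective_of_shift ψ hψ1 hψ2 hψ3
  have hmono := strictMono_of_deriv_pos hψ3
  set κ := Function.invFun ψ with hκdef
  have hr : ∀ s, ψ (κ s) = s := fun y => Function.invFun_eq (hbij.2 y)
  have hl : ∀ s, κ (ψ s) = s := Function.leftInverse_invFun hbij.1
  have hκ : (fun s => (κ s : ℂ)) ∈ CarlemanClass M := CarlemanClass.inverse hM hψ hψ3 hr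
  have hκmono : Monotone κ := fun x y hxy => hmono.le_iff_le.1 (by rwa [hr, hr])
  set F : ℝ → ℂ := fun s => (1 - (θ s : ℂ)) * χ s with hFdef
  -- Composing with κ once makes the backward series start at ψ^⟨-1⟩, so that index 0 is not counted
  -- twice.
  set G : ℝ → ℂ := fun s => (θ (κ s) : ℂ) * χ (κ s) with hGdef
  have hF : F ∈ CarlemanClass M :=
    CarlemanClass.mul hM (CarlemanClass.sub hM (CarlemanClass.const hM 1) hθ) hχ
  have hG : G ∈ CarlemanClass M :=
    CarlemanClass.comp hM (CarlemanClass.mul hM hθ hχ) hκ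
  have hF0 : ∀ t, b ≤ t → F t = 0 := fun t ht => by simp [hFdef, hθb t ht]
  have hG0 : ∀ t, κ t ≤ a → G t = 0 := fun t ht => by simp [hGdef, hθa _ ht]
  -- By monotonicity the entry time of the left endpoint serves every `s ≥ α`; this uniformity gives
  -- local finiteness. The backward sum uses the right endpoint likewise.
  have hFn : ∀ α, ∀ n ≥ NPlus ψ b α, ∀ s, α ≤ s → F (ψ^[n] s) = 0 := fun α n hn s hs =>
    hF0 _ ((le_iterate_of_NPlus_le hψ1 hψ3 hn).trans (hmono.monotone.iterate n hs))
  have hGn : ∀ β, ∀ n ≥ NMinus ψ a β, ∀ s ≤ β, G (κ^[n] s) = 0 := fun β n hn s hs => by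
    refine hG0 _ ?_
    rw [← Function.iterate_succ_apply' κ]
    exact (hκmono.iterate (n + 1) hs).trans
      (iterate_invFun_le_of_NMinus_le hψ1 hψ2 hψ3 (Nat.le_succ_of_le hn))
  obtain ⟨f, hf, hfs⟩ := CarlemanClass.exists_sum_iterate hM hψ hF
    fun α _ => ⟨NPlus ψ b α, fun n hn s hs => hFn α n hn s hs.1.le⟩
  obtain ⟨k, hk, hks⟩ := CarlemanClass.exists_sum_iterate hM hκ hG
    fun _ β => ⟨NMinus ψ a β, fun n hn s hs => hGn β n hn s hs.2.le⟩
  refine ⟨f - k, CarlemanClass.sub hM hf hk, ?_, fun s => ?_⟩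
  · ext s
    -- One superfluous zero term is kept at `s`: peeling off index 0 then leaves exactly the sum at
    -- `ψ s`. For `k` the roles of `s` and `ψ s` are exchanged.
    have hf1 := hfs s (NPlus ψ b s + 1) fun n hn => hFn s n (by omega) s le_rfl
    have hf2 := hfs (ψ s) (NPlus ψ b s) fun n hn => hFn s n hn _ (hψ1 s).le
    have hk1 := hks (ψ s) (NMinus ψ a (ψ s) + 1) fun n hn => hGn (ψ s) n (by omega) _ le_rfl
    have hk2 := hks s (NMinus ψ a (ψ s)) fun n hn => hGn (ψ s) n hn _ (hψ1 s).le
    rw [Finset.sum_range_succ'] at hf1 hk1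
    simp only [Function.iterate_succ_apply, Function.iterate_zero, id, hl] at hf1 hk1
    have hG1 : G (ψ s) = θ s * χ s := by simp [hGdef, hl]
    simp only [Pi.sub_apply, Function.comp_apply]
    rw [hf1, hf2, hk1, hk2, hG1, hFdef]
    ring
  · have hf1 := hfs s (NPlus ψ b s) fun n hn => hFn s n hn s le_rfl
    have hk1 := hks s (NMinus ψ a s) fun n hn => hGn s n hn s le_rfl
    have hFle : ∀ t, ‖F t‖ ≤ ‖χ t‖ := fun t => by
      have h : ‖(1 : ℂ) - (θ t : ℂ)‖ ≤ 1 := by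
        rw [← Complex.ofReal_one, ← Complex.ofReal_sub, Complex.norm_real, Real.norm_eq_abs,
          abs_le]
        constructor <;> linarith [(hθ01 t).1, (hθ01 t).2]
      rw [hFdef, norm_mul]
      exact mul_le_of_le_one_left (norm_nonneg _) h
    have hGle : ∀ t, ‖G t‖ ≤ ‖χ (κ t)‖ := fun t => by
      have h : ‖(θ (κ t) : ℂ)‖ ≤ 1 := by
        rw [Complex.norm_real, Real.norm_eq_abs, abs_le]
        constructor <;> linarith [(hθ01 (κ t)).1, (hθ01 (κ t)).2]
      rw [hGdef, norm_mul]
      exact mul_le_of_le_one_left (norm_nonneg _) h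
    rw [sum_Icc_neg_eq_sum_range (fun n => ‖χ (intIterate ψ n s)‖), Pi.sub_apply, hf1, hk1]
    refine (norm_sub_le _ _).trans (add_le_add ?_ ?_)
    · refine (norm_sum_le _ _).trans (Finset.sum_le_sum fun n _ => ?_)
      exact hFle _
    · refine (norm_sum_le _ _).trans (Finset.sum_le_sum fun n _ => ?_)
      -- The built-in κ in `G` turns the `n`-th backward term into the orbit point of index `-(n +
      -- 1)`.
      rw [intIterate_neg_natCast, Function.iterate_succ_apply']
      exact hGle _
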